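/- Let $d\in\mathbb N$ and let $r\in\{1,2,\dots,\infty,\omega\}$. A regular $k$-dimensional $C^r$ submanifold $M\subseteq\mathbb R^d$ (with or without boundary) is an embedded one: around each of its points an ambient $C^r$ chart straightens $M$ to $\mathbb R^k\times\{0\}$ or to the half-space $\{y\in\mathbb R^k\times\{0\}: y_k\ge 0\}$; $\operatorname{Int}M$ and $\partial M$ denote its manifold interior and boundary. Two submanifolds $M,N$ of $\mathbb R^d$ *perfectly align* if at least one of the pairs of boundary-free manifolds $(\operatorname{Int}M,\operatorname{Int}N)$, $(\operatorname{Int}M,\partial N)$, $(\partial M,\operatorname{Int}N)$, $(\partial M,\partial N)$ does not intersect transversally, i.e. $T_xA+T_xB\ne\mathbb R^d$ for some common point $x$ of the pair $(A,B)$. Say that a probability measure $P$ on $\mathbb R^d$ *lives on* a $k$-dimensional submanifold $M$ if $M$ is a regular $C^r$ submanifold that is a closed subset of $\mathbb R^d$, $k<d$, $\operatorname{supp}P\subseteq M$, and $P(A)=0$ for every $A\subseteq M$ of $k$-dimensional (surface) measure zero. Let $JSD(P\|Q)=\tfrac12 KL\big(P\,\big\|\,\tfrac{P+Q}2\big)+\tfrac12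 KL\big(Q\,\big\|\,\tfrac{P+Q}2\big)$. (a) Let $P_s,P_t$ be probability measures on $\mathbb R^d$ that live on submanifolds $M$ and $N$, respectively, and suppose that $M$ and $N$ do not perfectly align. Then $$JSD(P_s\|P_t)=\log 2 .$$ (b) Let $\mu_s,\mu_t$ be probability measures on a measurable space $X$, and for $\theta\in\mathbb R^q$ let $G_\theta:X\to\mathbb R^d$ and $T_\theta:\mathbb R^d\to\mathbb R^d$ be measurable. Let $P_s^\theta$ be the law of $T_\theta(G_\theta(x))$ for $x\sim\mu_s$ and $P_t^\theta$ the law of $G_\theta(x)$ for $x\sim\mu_t$. For measurable $D:\mathbb R^d\to[0,1]$ put $$\mathcal L(D,G_\theta,T_\theta)=\mathbb E_{x\sim\mu_s}[\log D(T_\theta(G_\theta(x)))]+\mathbb E_{x\sim\mu_t}[\log(1-D(G_\theta(x)))]\in[-\infty,0],$$ and let $D^*_\theta=\frac{dP_s^\theta}{d(P_s^\theta+P_t^\theta)}$. Suppose that for every $\theta$ in an open set $U\subseteq\mathbb R^q$ the measures $P_s^\theta,P_t^\theta$ live on submanifolds $M_\theta$ and $N_\theta$, respectively (which, like their dimensions,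 may depend on $\theta$), that do not perfectly align. Then for every $\theta\in U$: $D^*_\theta$ maximizes $\mathcal L(\cdot,G_\theta,T_\theta)$ over all measurable $D:\mathbb R^d\to[0,1]$; $JSD(P_s^\theta\|P_t^\theta)=\log 2$ and $$\mathcal L(D^*_\theta,G_\theta,T_\theta)=2\,JSD(P_s^\theta\|P_t^\theta)-2\log 2=0;$$ and the functions $\theta\mapsto JSD(P_s^\theta\|P_t^\theta)$ and $\theta\mapsto\mathcal L(D^*_\theta,G_\theta,T_\theta)$ are differentiable at every point of $U$ with gradient zero. -/

import Mathlib

open MeasureTheory Set Filter Topology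
open scoped ENNReal Pointwise

noncomputable section

/-- The coordinate slice `ℝᵏ × {0}` of `ℝᵈ`. -/
def coordSlice (d k : ℕ) : Set (EuclideanSpace ℝ (Fin d)) :=
  {y | ∀ i : Fin d, k ≤ i.val → y i = 0}

/-- The half-space `{y ∈ ℝᵏ × {0} | y_k ≥ 0}` of the coordinate slice (coordinates are
numbered from zero in the code, so that the last free coordinate has index `k - 1`). -/
def coordHalfSlice (d k : ℕ) : Set (EuclideanSpace ℝ (Fin d)) :=
  {y | y ∈ coordSlice d k ∧ ∀ i : Fin d, i.val + 1 = k → 0 ≤ y i}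

/-- `φ` is a `C^r` diffeomorphism between open subsets of `ℝᵈ` that carries `M` to `S`, that is
`φ (M ∩ source) = S ∩ target`. -/
def IsAdaptedChart {d : ℕ} (r : WithTop ℕ∞) (M S : Set (EuclideanSpace ℝ (Fin d)))
    (φ : OpenPartialHomeomorph (EuclideanSpace ℝ (Fin d)) (EuclideanSpace ℝ (Fin d))) : Prop :=
  ContDiffOn ℝ r φ φ.source ∧ ContDiffOn ℝ r φ.symm φ.target ∧ φ.IsImage M S

/-- The manifold interior `Int M` of a `k`-dimensional submanifold `M` of `ℝᵈ`: the points with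
a chart that straightens `M` to a coordinate slice. -/
def manifoldInterior {d : ℕ} (r : WithTop ℕ∞) (k : ℕ) (M : Set (EuclideanSpace ℝ (Fin d))) :
    Set (EuclideanSpace ℝ (Fin d)) :=
  {x | x ∈ M ∧ ∃ φ, x ∈ φ.source ∧ IsAdaptedChart r M (coordSlice d k) φ}

/-- The manifold boundary `∂M`. -/
def manifoldBoundary {d : ℕ} (r : WithTop ℕ∞) (k : ℕ) (M : Set (EuclideanSpace ℝ (Fin d))) :
    Set (EuclideanSpace ℝ (Fin d)) :=
  M \ manifoldInterior r k M

/-- `M` is a regular (embedded) `k`-dimensional `C^r` submanifold of `ℝᵈ`, with or without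
boundary: around each of its points, `M` is straightened by an ambient chart to a coordinate slice
or to a half-space of a coordinate slice. -/
def IsRegularSubmanifold {d : ℕ} (r : WithTop ℕ∞) (k : ℕ)
    (M : Set (EuclideanSpace ℝ (Fin d))) : Prop :=
  k ≤ d ∧ ∀ x ∈ M, ∃ φ, x ∈ φ.source ∧
    (IsAdaptedChart r M (coordSlice d k) φ ∨ IsAdaptedChart r M (coordHalfSlice d k) φ)

/-- The tangent space at `x` of a boundary-free submanifold `A` of `ℝᵈ`: the velocities at `x` of
the curves in `A` through `x`. -/
def tangentVectors {d : ℕ} (A : Set (EuclideanSpace ℝ (Fin d))) (x : EuclideanSpace ℝ (Fin d)) :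
    Set (EuclideanSpace ℝ (Fin d)) :=
  {v | ∃ γ : ℝ → EuclideanSpace ℝ (Fin d),
    γ 0 = x ∧ (∀ᶠ t in 𝓝 (0 : ℝ), γ t ∈ A) ∧ HasDerivAt γ v 0}

/-- Two boundary-free submanifolds `A`, `B` of `ℝᵈ` intersect transversally:
`T_x A + T_x B = ℝᵈ` at every common point `x`. -/
def IntersectTransversally {d : ℕ} (A B : Set (EuclideanSpace ℝ (Fin d))) : Prop :=
  ∀ x ∈ A ∩ B, tangentVectors A x + tangentVectors B x = univ

/-- Two submanifolds `M`, `N` of dimensions `m`, `n`, with or without boundary, perfectly align if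
one of the pairs `(Int M, Int N)`, `(Int M, ∂N)`, `(∂M, Int N)`, `(∂M, ∂N)` of boundary-free
manifolds fails to intersect transversally. -/
def PerfectlyAlign {d : ℕ} (r : WithTop ℕ∞) (m : ℕ) (M : Set (EuclideanSpace ℝ (Fin d)))
    (n : ℕ) (N : Set (EuclideanSpace ℝ (Fin d))) : Prop :=
  ¬ IntersectTransversally (manifoldInterior r m M) (manifoldInterior r n N) ∨
  ¬ IntersectTransversally (manifoldInterior r m M) (manifoldBoundary r n N) ∨
  ¬ IntersectTransversally (manifoldBoundary r m M) (manifoldInterior r n N) ∨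
  ¬ IntersectTransversally (manifoldBoundary r m M) (manifoldBoundary r n N)

/-- `P` is continuous in the `k`-dimensional submanifold `M`: it gives mass zero to the sets of
measure zero in `M`. The measure of `M` is the `k`-dimensional Hausdorff (surface) measure. -/
def IsContinuousIn {d : ℕ} (P : Measure (EuclideanSpace ℝ (Fin d))) (k : ℕ)
    (M : Set (EuclideanSpace ℝ (Fin d))) : Prop :=
  ∀ A ⊆ M, Measure.hausdorffMeasure (k : ℝ) A = 0 → P A = 0

/-- `P` has support contained in the set `M`, which is a closed regular submanifold of dimension
`k < d`, and is continuous in `M`. -/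
structure LivesOnLowDimManifold {d : ℕ} (r : WithTop ℕ∞) (P : Measure (EuclideanSpace ℝ (Fin d)))
    (k : ℕ) (M : Set (EuclideanSpace ℝ (Fin d))) : Prop where
  isClosed : IsClosed M
  isRegularSubmanifold : IsRegularSubmanifold r k M
  dim_lt : k < d
  support_subset : P.support ⊆ M
  isContinuousIn : IsContinuousIn P k M

/-- The Jensen-Shannon divergence `(KL(P ‖ R) + KL(Q ‖ R)) / 2` with `R = (P + Q) / 2`. -/
def jsDiv {Z : Type*} [MeasurableSpace Z] (P Q : Measure Z) : ℝ≥0∞ :=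
  (InformationTheory.klDiv P ((2 : ℝ≥0∞)⁻¹ • (P + Q)) +
    InformationTheory.klDiv Q ((2 : ℝ≥0∞)⁻¹ • (P + Q))) / 2

/-- A domain classifier: a measurable function with values in `[0, 1]`. -/
def IsDiscriminator {Z : Type*} [MeasurableSpace Z] (D : Z → ℝ≥0∞) : Prop :=
  Measurable D ∧ ∀ z, D z ≤ 1

/-- The cross entropy `-log p`, in `[0, ∞]`, of a probability `p ∈ [0, 1]`. -/
def negLog (p : ℝ≥0∞) : ℝ≥0∞ := (-ENNReal.log p).toENNReal

/-- The adversarial objective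
`L(D, G, T) = E_{x ∼ μs} [log D(T(G(x)))] + E_{x ∼ μt} [log (1 - D(G(x)))]`, in `[-∞, 0]`. -/
def adversarialObjective {X Z : Type*} [MeasurableSpace X] (μs μt : Measure X)
    (D : Z → ℝ≥0∞) (G : X → Z) (T : Z → Z) : EReal :=
  -(((∫⁻ x, negLog (D (T (G x))) ∂μs) + ∫⁻ x, negLog (1 - D (G x)) ∂μt : ℝ≥0∞) : EReal)

/-- The discriminator `D* = dP / d(P + Q)`, in the version with values in `[0, 1]` everywhere. -/
def optimalDiscriminator {Z : Type*} [MeasurableSpace Z] (P Q : Measure Z) : Z → ℝ≥0∞ :=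
  fun z => min (P.rnDeriv (P + Q) z) 1

/-- The source feature distribution, the law of `T(G(x))` for `x ∼ μs`. -/
def sourceLaw {X Z : Type*} [MeasurableSpace X] [MeasurableSpace Z] (μs : Measure X)
    (G : X → Z) (T : Z → Z) : Measure Z :=
  μs.map (fun x => T (G x))

/-- The target feature distribution, the law of `G(x)` for `x ∼ μt`. -/
def targetLaw {X Z : Type*} [MeasurableSpace X] [MeasurableSpace Z] (μt : Measure X)
    (G : X → Z) : Measure Z :=
  μt.map G

/-- The objective `L(D*, G, T)` at the optimal discriminator of the pair `(G, T)`. -/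
def objectiveAtOptimum {X Z : Type*} [MeasurableSpace X] [MeasurableSpace Z] (μs μt : Measure X)
    (G : X → Z) (T : Z → Z) : EReal :=
  adversarialObjective μs μt (optimalDiscriminator (sourceLaw μs G T) (targetLaw μt G)) G T

end

/-! Everything follows from `P ⟂ₘ Q`. In that case `P` has density 2 with respect to `(P + Q)/2`,
`P`-a.e., and symmetrically for `Q`, so both divergences equal `log 2`. Moreover `D*` is 1 `P`-a.e.
and 0 `Q`-a.e., so the objective attains its trivial upper bound 0. On the open set `U` both
functions of `θ` are therefore constant, and their gradients vanish.

Singularity is geometric (`LivesOnLowDimManifold.mutuallySingular`). The set `N` carries `Q`, and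
`P` gives it no mass because `M ∩ N` is null for the surface measure of `M`. Indeed `M ∩ N` is
covered by `∂M`, which locally has dimension `m - 1`, and by the intersections of `Int M` with `Int
N` and `∂N`. At a transversal point of the latter, `n < d` prevents the tangent vectors of `M` from
all being tangent to `N`, so some defining equation of `N` cuts `M` down to a hypersurface of `M`
(`exists_nhdsWithin_inter_hausdorffMeasure_eq_zero`). -/

/-! ### Divergence and objective for mutually singular measures. -/

section Divergence

variable {Z : Type*} [MeasurableSpace Z]

lemma rnDeriv_add_eq_one_of_mutuallySingular {P Q : Measure Z} [IsFiniteMeasure P]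
    [IsFiniteMeasure Q] (h : P ⟂ₘ Q) : P.rnDeriv (P + Q) =ᵐ[P] fun _ => 1 :=
  (Measure.rnDeriv_add_right_of_mutuallySingular h).trans P.rnDeriv_self

lemma rnDeriv_half_smul_add_of_mutuallySingular {P Q : Measure Z} [IsFiniteMeasure P]
    [IsFiniteMeasure Q] (h : P ⟂ₘ Q) :
    P.rnDeriv ((2 : ℝ≥0∞)⁻¹ • (P + Q)) =ᵐ[P] fun _ => 2 := by
  have hac : P ≪ P + Q := Measure.AbsolutelyContinuous.rfl.add_right _
  have h1 := Measure.rnDeriv_smul_right_of_ne_top P (P + Q) (r := (2 : ℝ≥0∞)⁻¹)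
    (by simp) (by simp)
  filter_upwards [hac.ae_le h1, rnDeriv_add_eq_one_of_mutuallySingular h] with z hz hz'
  rw [hz, Pi.smul_apply, hz']
  simp

lemma klDiv_half_smul_add_of_mutuallySingular {P Q : Measure Z} [IsProbabilityMeasure P]
    [IsProbabilityMeasure Q] (h : P ⟂ₘ Q) :
    InformationTheory.klDiv P ((2 : ℝ≥0∞)⁻¹ • (P + Q)) = ENNReal.ofReal (Real.log 2) := by
  have hac : P ≪ (2 : ℝ≥0∞)⁻¹ • (P + Q) :=
    (Measure.AbsolutelyContinuous.rfl.add_right _).trans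
      (Measure.absolutelyContinuous_smul (by simp))
  have hllr : llr P ((2 : ℝ≥0∞)⁻¹ • (P + Q)) =ᵐ[P] fun _ => Real.log 2 := by
    filter_upwards [rnDeriv_half_smul_add_of_mutuallySingular h] with z hz
    rw [llr, hz, ENNReal.toReal_ofNat]
  rw [InformationTheory.klDiv_of_ac_of_integrable hac
    ((integrable_congr hllr).2 (integrable_const _)), integral_congr_ae hllr]
  -- `klDiv` contains the correction term `ν.real univ - μ.real univ`, which vanishes because both
  -- masses are 1.
  have huniv : ((2 : ℝ≥0∞)⁻¹ • (P + Q)).real univ = 1 := by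
    simp [Measure.real, ENNReal.inv_two_add_inv_two]
  rw [huniv]
  simp

/-- The Jensen-Shannon divergence of mutually singular probability measures is `log 2`. -/
lemma jsDiv_of_mutuallySingular {P Q : Measure Z} [IsProbabilityMeasure P]
    [IsProbabilityMeasure Q] (h : P ⟂ₘ Q) : jsDiv P Q = ENNReal.ofReal (Real.log 2) := by
  rw [jsDiv, klDiv_half_smul_add_of_mutuallySingular h, add_comm P Q,
    klDiv_half_smul_add_of_mutuallySingular h.symm, ENNReal.add_div, ENNReal.add_halves]

lemma optimalDiscriminator_eq_one_of_mutuallySingular {P Q : Measure Z} [IsFiniteMeasure P]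
    [IsFiniteMeasure Q] (h : P ⟂ₘ Q) : ∀ᵐ z ∂P, optimalDiscriminator P Q z = 1 := by
  filter_upwards [rnDeriv_add_eq_one_of_mutuallySingular h] with z hz
  simp [optimalDiscriminator, hz]

lemma optimalDiscriminator_eq_zero_of_mutuallySingular {P Q : Measure Z} [IsFiniteMeasure P]
    [IsFiniteMeasure Q] (h : P ⟂ₘ Q) : ∀ᵐ z ∂Q, optimalDiscriminator P Q z = 0 := by
  have hac : Q ≪ P + Q := add_comm P Q ▸ Measure.AbsolutelyContinuous.rfl.add_right _
  filter_upwards [Measure.rnDeriv_eq_zero_of_mutuallySingular h hac] with z hz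
  simp [optimalDiscriminator, hz]

lemma negLog_one : negLog 1 = 0 := by simp [negLog]

/-- Gives the optimality of `D*` once the objective at `D*` is known to be 0. -/
lemma adversarialObjective_nonpos {X Z : Type*} [MeasurableSpace X] (μs μt : Measure X)
    (D : Z → ℝ≥0∞) (G : X → Z) (T : Z → Z) : adversarialObjective μs μt D G T ≤ 0 := by
  rw [adversarialObjective, EReal.neg_le, neg_zero]
  exact EReal.coe_ennreal_nonneg _

lemma objectiveAtOptimum_of_mutuallySingular {X : Type*} [MeasurableSpace X] {μs μt : Measure X}
    [IsFiniteMeasure μs] [IsFiniteMeasure μt] {G : X → Z} {T : Z → Z} (hG : Measurable G)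
    (hT : Measurable T) (h : sourceLaw μs G T ⟂ₘ targetLaw μt G) :
    objectiveAtOptimum μs μt G T = 0 := by
  have : IsFiniteMeasure (sourceLaw μs G T) := by unfold sourceLaw; infer_instance
  have : IsFiniteMeasure (targetLaw μt G) := by unfold targetLaw; infer_instance
  have hs : ∀ᵐ x ∂μs,
      optimalDiscriminator (sourceLaw μs G T) (targetLaw μt G) (T (G x)) = 1 :=
    ae_of_ae_map (hT.comp hG).aemeasurable (optimalDiscriminator_eq_one_of_mutuallySingular h)
  have ht : ∀ᵐ x ∂μt, optimalDiscriminator (sourceLaw μs G T) (targetLaw μt G) (G x) = 0 :=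
    ae_of_ae_map hG.aemeasurable (optimalDiscriminator_eq_zero_of_mutuallySingular h)
  have h1 : ∫⁻ x, negLog (optimalDiscriminator (sourceLaw μs G T) (targetLaw μt G) (T (G x))) ∂μs
      = 0 := by
    refine lintegral_eq_zero_of_ae_eq_zero ?_
    filter_upwards [hs] with x hx
    simp [hx, negLog_one]
  have h2 : ∫⁻ x, negLog (1 - optimalDiscriminator (sourceLaw μs G T) (targetLaw μt G) (G x)) ∂μt
      = 0 := by
    refine lintegral_eq_zero_of_ae_eq_zero ?_
    filter_upwards [ht] with x hx
    simp [hx, negLog_one]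
  rw [objectiveAtOptimum, adversarialObjective, h1, h2]
  simp

end Divergence

/-! ### Null sets of Hausdorff measure. -/

section Hausdorff

variable {E : Type*} [NormedAddCommGroup E] [NormedSpace ℝ E] [FiniteDimensional ℝ E]
  [MeasurableSpace E] [BorelSpace E]

lemma hausdorffMeasure_submodule_eq_zero (W : Submodule ℝ E) {m : ℕ}
    (hW : Module.finrank ℝ W < m) : Measure.hausdorffMeasure (m : ℝ) (W : Set E) = 0 := by
  have hdim : dimH (W : Set E) = Module.finrank ℝ W := by
    have := (isometry_subtype_coe (s := (W : Set E))).dimH_image univ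
    rw [image_univ, Subtype.range_coe] at this
    rw [this]
    exact Real.dimH_univ_eq_finrank W
  have := hausdorffMeasure_of_dimH_lt (s := (W : Set E)) (d := (m : NNReal))
    (by rw [hdim]; exact_mod_cast hW)
  simpa using this

/-- A set that a local diffeomorphism carries into a subspace of dimension less than `m` is locally
null for the `m`-dimensional Hausdorff measure. -/
lemma exists_nhdsWithin_hausdorffMeasure_eq_zero {S : Set E} {x : E} {h : E → E} {h' : E ≃L[ℝ] E}
    (hh : HasStrictFDerivAt h (h' : E →L[ℝ] E) x) {W : Submodule ℝ E} {m : ℕ}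
    (hW : Module.finrank ℝ W < m) (hS : ∀ᶠ y in 𝓝 x, y ∈ S → h y ∈ W) :
    ∃ u ∈ 𝓝[S] x, Measure.hausdorffMeasure (m : ℝ) u = 0 := by
  obtain ⟨s, hxs, hso, happ⟩ := hh.approximates_deriv_on_open_nhds
  -- Near a point with invertible strict derivative, `h` expands distances up to a constant, so
  -- preimages of null sets are null.
  have hanti := happ.antilipschitz (h'.subsingleton_or_nnnorm_symm_pos.imp id
    fun hpos => NNReal.half_lt_self (inv_pos.2 hpos).ne')
  have hnull : Measure.hausdorffMeasure (m : ℝ) (s.domRestrict h ⁻¹' (W : Set E)) = 0 := by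
    have := hanti.hausdorffMeasure_preimage_le (d := (m : ℝ)) (by positivity) (W : Set E)
    rwa [hausdorffMeasure_submodule_eq_zero W hW, mul_zero, nonpos_iff_eq_zero] at this
  refine ⟨Subtype.val '' (s.domRestrict h ⁻¹' (W : Set E)), ?_, ?_⟩
  · rw [mem_nhdsWithin_iff_eventually]
    filter_upwards [hS, hso.mem_nhds hxs] with y hy hys hyS
    exact ⟨⟨y, hys⟩, hy hyS, rfl⟩
  · rw [(isometry_subtype_coe (s := s)).hausdorffMeasure_image (Or.inl (by positivity)), hnull]

end Hausdorff

/-! ### Linear algebra of coordinate slices. -/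

section CoordinateSlices

/-- The coordinate slice `ℝᵏ × {0}` as a subspace of `ℝᵈ`. -/
def coordSubmodule (d k : ℕ) : Submodule ℝ (EuclideanSpace ℝ (Fin d)) where
  carrier := coordSlice d k
  add_mem' ha hb i hi := by simp [ha i hi, hb i hi]
  zero_mem' i _ := rfl
  smul_mem' c a ha i hi := by simp [ha i hi]

lemma coordHalfSlice_subset_coordSlice (d k : ℕ) : coordHalfSlice d k ⊆ coordSlice d k :=
  fun _ hy => hy.1

lemma single_mem_coordSubmodule {d k : ℕ} {i : Fin d} (hi : i.val < k) :
    EuclideanSpace.single i (1 : ℝ) ∈ coordSubmodule d k := by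
  intro j hj
  have : j ≠ i := by rintro rfl; omega
  simp [this]

lemma finrank_coordSubmodule_le {d k : ℕ} (hk : k ≤ d) :
    Module.finrank ℝ (coordSubmodule d k) ≤ k := by
  let f : coordSubmodule d k →ₗ[ℝ] (Fin k → ℝ) :=
    { toFun := fun y i => y.1 (Fin.castLE hk i)
      map_add' := fun _ _ => rfl
      map_smul' := fun _ _ => rfl }
  have hf : Function.Injective f := by
    intro y z hyz
    ext i
    by_cases hi : i.val < k
    · exact congrFun hyz ⟨i.val, hi⟩
    · rw [y.2 i (not_lt.1 hi), z.2 i (not_lt.1 hi)]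
  simpa using LinearMap.finrank_le_finrank_of_injective hf

/-- One nontrivial linear equation lowers the dimension. This is the source of nullity both for the
boundary and for transversal intersections. -/
lemma finrank_coordSubmodule_inf_ker_lt {d k : ℕ} (hk : k ≤ d)
    (L : EuclideanSpace ℝ (Fin d) →ₗ[ℝ] ℝ) {v : EuclideanSpace ℝ (Fin d)}
    (hv : v ∈ coordSubmodule d k) (hLv : L v ≠ 0) :
    Module.finrank ℝ (coordSubmodule d k ⊓ LinearMap.ker L : Submodule ℝ _) < k := by
  refine (Submodule.finrank_lt_finrank_of_lt ?_).trans_le (finrank_coordSubmodule_le hk)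
  exact lt_of_le_of_ne inf_le_left fun h => hLv (inf_eq_left.1 h hv)

end CoordinateSlices

/-! ### Adapted charts, transversality and nullity of the intersection. -/

section Charts

variable {d : ℕ} {r : WithTop ℕ∞} {M S : Set (EuclideanSpace ℝ (Fin d))}
  {φ : OpenPartialHomeomorph (EuclideanSpace ℝ (Fin d)) (EuclideanSpace ℝ (Fin d))}

/-- Differentiating both inverse identities between `φ` and `φ.symm` produces a two-sided inverse of
the derivative; `1 ≤ r` makes the derivative strict. -/
lemma IsAdaptedChart.exists_hasStrictFDerivAt (hφ : IsAdaptedChart r M S φ) (hr : 1 ≤ r)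
    {x : EuclideanSpace ℝ (Fin d)} (hx : x ∈ φ.source) :
    ∃ φ' : EuclideanSpace ℝ (Fin d) ≃L[ℝ] EuclideanSpace ℝ (Fin d),
      HasStrictFDerivAt φ (φ' : EuclideanSpace ℝ (Fin d) →L[ℝ] EuclideanSpace ℝ (Fin d)) x := by
  have hr0 : r ≠ 0 := (zero_lt_one.trans_le hr).ne'
  have h1 := (hφ.1.contDiffAt (φ.open_source.mem_nhds hx)).hasStrictFDerivAt hr0
  have h2 := (hφ.2.1.contDiffAt
    (φ.open_target.mem_nhds (φ.map_source hx))).hasStrictFDerivAt hr0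
  have h3 : HasFDerivAt φ (fderiv ℝ φ x) (φ.symm (φ x)) := by
    rw [φ.left_inv hx]; exact h1.hasFDerivAt
  have hl : (fderiv ℝ φ.symm (φ x)).comp (fderiv ℝ φ x) = ContinuousLinearMap.id ℝ _ :=
    (h2.hasFDerivAt.comp x h1.hasFDerivAt).unique ((hasFDerivAt_id x).congr_of_eventuallyEq
      (φ.eventually_left_inverse hx))
  have hrr : (fderiv ℝ φ x).comp (fderiv ℝ φ.symm (φ x)) = ContinuousLinearMap.id ℝ _ :=
    (h3.comp (φ x) h2.hasFDerivAt).unique ((hasFDerivAt_id (φ x)).congr_of_eventuallyEq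
      (φ.eventually_right_inverse (φ.map_source hx)))
  exact ⟨ContinuousLinearEquiv.equivOfInverse (fderiv ℝ φ x) (fderiv ℝ φ.symm (φ x))
    (fun v => by simpa using congrArg (· v) hl) (fun v => by simpa using congrArg (· v) hrr), h1⟩

lemma IsAdaptedChart.eventually_mem (hφ : IsAdaptedChart r M S φ)
    {x : EuclideanSpace ℝ (Fin d)} (hx : x ∈ φ.source) : ∀ᶠ y in 𝓝 x, y ∈ M → φ y ∈ S := by
  filter_upwards [φ.open_source.mem_nhds hx] with y hy hyM
  exact (hφ.2.2 hy).2 hyM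

/-- The tangent vectors to a set that `F` carries into a coordinate slice are carried into that
slice by the derivative of `F`. -/
lemma HasFDerivAt.mem_coordSubmodule_of_mem_tangentVectors {k : ℕ}
    {F : EuclideanSpace ℝ (Fin d) → EuclideanSpace ℝ (Fin d)}
    {F' : EuclideanSpace ℝ (Fin d) →L[ℝ] EuclideanSpace ℝ (Fin d)}
    {A : Set (EuclideanSpace ℝ (Fin d))} {x v : EuclideanSpace ℝ (Fin d)}
    (hF : HasFDerivAt F F' x) (hA : ∀ᶠ y in 𝓝 x, y ∈ A → F y ∈ coordSlice d k)
    (hv : v ∈ tangentVectors A x) : F' v ∈ coordSubmodule d k := by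
  obtain ⟨γ, hγ0, hγA, hγ⟩ := hv
  intro i hi
  subst hγ0
  have h1 : HasDerivAt (fun t => F (γ t) i) (F' v i) 0 :=
    (EuclideanSpace.proj (𝕜 := ℝ) i).hasFDerivAt.comp_hasDerivAt (0 : ℝ)
      (hF.comp_hasDerivAt (0 : ℝ) hγ)
  have h2 : (fun t => F (γ t) i) =ᶠ[𝓝 0] fun _ => (0 : ℝ) := by
    filter_upwards [hγA, hγ.continuousAt.eventually hA] with t ht ht'
    exact ht' ht i hi
  exact h1.unique ((hasDerivAt_const (0 : ℝ) (0 : ℝ)).congr_of_eventuallyEq h2)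

/-- Near a transversal intersection point of `A` and `B`, where `A` is straightened to `ℝᵐ × {0}`
and `B` is carried into `ℝⁿ × {0}` with `n < d`, the intersection is null in dimension `m`. -/
lemma exists_nhdsWithin_inter_hausdorffMeasure_eq_zero {m n : ℕ} (hm : m ≤ d) (hn : n < d)
    {F H : EuclideanSpace ℝ (Fin d) → EuclideanSpace ℝ (Fin d)}
    {F' H' : EuclideanSpace ℝ (Fin d) ≃L[ℝ] EuclideanSpace ℝ (Fin d)}
    {A B : Set (EuclideanSpace ℝ (Fin d))} {x : EuclideanSpace ℝ (Fin d)}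
    (hF : HasStrictFDerivAt F (F' : EuclideanSpace ℝ (Fin d) →L[ℝ] EuclideanSpace ℝ (Fin d)) x)
    (hH : HasStrictFDerivAt H (H' : EuclideanSpace ℝ (Fin d) →L[ℝ] EuclideanSpace ℝ (Fin d)) x)
    (hA : ∀ᶠ y in 𝓝 x, y ∈ A → F y ∈ coordSlice d m)
    (hB : ∀ᶠ y in 𝓝 x, y ∈ B → H y ∈ coordSlice d n)
    (htrans : tangentVectors A x + tangentVectors B x = univ) :
    ∃ u ∈ 𝓝[A ∩ B] x, Measure.hausdorffMeasure (m : ℝ) u = 0 := by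
  -- Otherwise `H'` would map both tangent sets into `ℝⁿ × {0}`, hence by transversality all of
  -- `ℝᵈ`, contradicting surjectivity since `n < d`.
  obtain ⟨v, hv, j, hj, hvj⟩ : ∃ v ∈ coordSubmodule d m, ∃ j : Fin d, n ≤ j.val ∧
      H' (F'.symm v) j ≠ 0 := by
    by_contra! hcon
    have hall : ∀ w, H' w ∈ coordSubmodule d n := by
      intro w
      obtain ⟨a, ha, b, hb, rfl⟩ : w ∈ tangentVectors A x + tangentVectors B x :=
        htrans ▸ mem_univ w
      have ha' := hcon _ (hF.hasFDerivAt.mem_coordSubmodule_of_mem_tangentVectors hA ha)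
      have hb' := hH.hasFDerivAt.mem_coordSubmodule_of_mem_tangentVectors hB hb
      rw [map_add]
      exact add_mem (fun i hi => by simpa using ha' i hi) hb'
    have := hall (H'.symm (EuclideanSpace.single ⟨n, hn⟩ 1)) ⟨n, hn⟩ le_rfl
    simp at this
  let P : EuclideanSpace ℝ (Fin d) →L[ℝ] ℝ := EuclideanSpace.proj j
  let L : EuclideanSpace ℝ (Fin d) →L[ℝ] ℝ :=
    (P.comp (H' : EuclideanSpace ℝ (Fin d) →L[ℝ] EuclideanSpace ℝ (Fin d))).comp
      (F'.symm : EuclideanSpace ℝ (Fin d) →L[ℝ] EuclideanSpace ℝ (Fin d))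
  have hLv : L v ≠ 0 := hvj
  -- replace the `L`-coordinate of `F` by the function `P ∘ H`, which has the same derivative
  let h : EuclideanSpace ℝ (Fin d) → EuclideanSpace ℝ (Fin d) :=
    fun y => F y + (P (H y) - L (F y)) • ((L v)⁻¹ • v)
  have hh : HasStrictFDerivAt h
      (F' : EuclideanSpace ℝ (Fin d) →L[ℝ] EuclideanSpace ℝ (Fin d)) x := by
    have h1 := (P.hasStrictFDerivAt.comp x hH).sub (L.hasStrictFDerivAt.comp x hF)
    have h2 := hF.add (h1.smul_const ((L v)⁻¹ • v))
    refine h2.congr_fderiv ?_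
    ext1 w
    simp [L]
  refine exists_nhdsWithin_hausdorffMeasure_eq_zero hh
    (finrank_coordSubmodule_inf_ker_lt hm (L : EuclideanSpace ℝ (Fin d) →ₗ[ℝ] ℝ) hv hLv) ?_
  filter_upwards [hA, hB] with y hyA hyB hy
  -- The correction is a multiple of `v`, so `h y` stays in the slice. On `B` the term `P (H y)`
  -- vanishes, and the correction then cancels `L (F y)` exactly.
  refine ⟨add_mem (hyA hy.1) (Submodule.smul_mem _ _ (Submodule.smul_mem _ _ hv)), ?_⟩
  have hPH : P (H y) = 0 := hyB hy.2 j hj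
  change L (h y) = 0
  simp only [h, map_add, map_smul, hPH, smul_eq_mul]
  field_simp
  ring

lemma IsRegularSubmanifold.exists_slice_chart {k : ℕ} (hM : IsRegularSubmanifold r k M)
    {x : EuclideanSpace ℝ (Fin d)} (hx : x ∈ M) :
    ∃ φ : OpenPartialHomeomorph (EuclideanSpace ℝ (Fin d)) (EuclideanSpace ℝ (Fin d)),
      x ∈ φ.source ∧ ∃ S ⊆ coordSlice d k, IsAdaptedChart r M S φ := by
  obtain ⟨φ, hxφ, hφ | hφ⟩ := hM.2 x hx
  · exact ⟨φ, hxφ, _, Subset.rfl, hφ⟩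
  · exact ⟨φ, hxφ, _, coordHalfSlice_subset_coordSlice d k, hφ⟩

/-- In a half-space chart, the points of `M` with positive last coordinate are interior. -/
lemma IsAdaptedChart.mem_manifoldInterior_of_pos {k : ℕ}
    (hφ : IsAdaptedChart r M (coordHalfSlice d k) φ) {y : EuclideanSpace ℝ (Fin d)} (hyM : y ∈ M)
    (hy : y ∈ φ.source) (hpos : ∀ i : Fin d, i.val + 1 = k → 0 < φ y i) :
    y ∈ manifoldInterior r k M := by
  have hopen : IsOpen {z : EuclideanSpace ℝ (Fin d) | ∀ i : Fin d, i.val + 1 = k → 0 < z i} := by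
    simp only [ofPred_forall]
    exact isOpen_iInter_of_finite fun i => isOpen_iInter_of_finite fun _ =>
      isOpen_lt continuous_const (EuclideanSpace.proj (𝕜 := ℝ) i).continuous
  -- Over the open set of positive last coordinate, the half-slice and the slice coincide.
  let e := φ.trans (OpenPartialHomeomorph.ofSet _ hopen)
  have hsource : ∀ z ∈ e.source, z ∈ φ.source ∧ ∀ i : Fin d, i.val + 1 = k → 0 < φ z i := by
    intro z hz
    simpa [e] using hz
  have htarget : e.target ⊆ φ.target := by
    intro z hz
    have := hz.2
    simpa [e] using this
  refine ⟨hyM, e, by simpa [e] using ⟨hy, hpos⟩, ?_, ?_, ?_⟩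
  · exact hφ.1.mono fun z hz => (hsource z hz).1
  · exact hφ.2.1.mono htarget
  · intro z hz
    obtain ⟨hz1, hz2⟩ := hsource z hz
    refine Iff.trans ?_ (hφ.2.2 hz1)
    exact ⟨fun h => ⟨h, fun i hi => (hz2 i hi).le⟩, fun h => h.1⟩

/-- A half-space chart sends boundary points to last coordinate 0, since a positive one would make
them interior. -/
lemma IsRegularSubmanifold.hausdorffMeasure_manifoldBoundary {k : ℕ} (hr : 1 ≤ r)
    (hM : IsRegularSubmanifold r k M) :
    Measure.hausdorffMeasure (k : ℝ) (manifoldBoundary r k M) = 0 := by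
  refine measure_null_of_locally_null _ fun x hx => ?_
  obtain ⟨φ, hxφ, hφ | hφ⟩ := hM.2 x hx.1
  · exact absurd ⟨hx.1, φ, hxφ, hφ⟩ hx.2
  obtain ⟨φ', hφ'⟩ := hφ.exists_hasStrictFDerivAt hr hxφ
  -- If no such coordinate exists (`k = 0`), the half-space condition is vacuous and `x` would be
  -- interior.
  obtain ⟨i, hi⟩ : ∃ i : Fin d, i.val + 1 = k := by
    by_contra! hcon
    exact hx.2 (hφ.mem_manifoldInterior_of_pos hx.1 hxφ fun i hi => absurd hi (hcon i))
  let L : EuclideanSpace ℝ (Fin d) →L[ℝ] ℝ := EuclideanSpace.proj i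
  refine exists_nhdsWithin_hausdorffMeasure_eq_zero hφ'
    (finrank_coordSubmodule_inf_ker_lt hM.1 (L : EuclideanSpace ℝ (Fin d) →ₗ[ℝ] ℝ)
      (single_mem_coordSubmodule (i := i) (by omega)) (by simp [L])) ?_
  filter_upwards [φ.open_source.mem_nhds hxφ] with y hy hyM
  have hyS := (hφ.2.2 hy).2 hyM.1
  refine ⟨hyS.1, ?_⟩
  change φ y i = 0
  refine le_antisymm (not_lt.1 fun hlt => hyM.2 ?_) (hyS.2 i hi)
  refine hφ.mem_manifoldInterior_of_pos hyM.1 hy fun j hj => ?_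
  obtain rfl : j = i := Fin.ext (by omega)
  exact hlt

/-- Applied with `B` the interior and the boundary of `N`. The chart of `N` only has to map `B` into
a slice, so half-space charts serve as well. -/
lemma hausdorffMeasure_manifoldInterior_inter {m n : ℕ} {N B : Set (EuclideanSpace ℝ (Fin d))}
    (hr : 1 ≤ r) (hm : m ≤ d) (hn : n < d) (hN : IsRegularSubmanifold r n N) (hB : B ⊆ N)
    (htrans : IntersectTransversally (manifoldInterior r m M) B) :
    Measure.hausdorffMeasure (m : ℝ) (manifoldInterior r m M ∩ B) = 0 := by
  refine measure_null_of_locally_null _ fun x hx => ?_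
  obtain ⟨φ, hxφ, hφ⟩ := hx.1.2
  obtain ⟨ψ, hxψ, S, hS, hψ⟩ := hN.exists_slice_chart (hB hx.2)
  obtain ⟨φ', hφ'⟩ := hφ.exists_hasStrictFDerivAt hr hxφ
  obtain ⟨ψ', hψ'⟩ := hψ.exists_hasStrictFDerivAt hr hxψ
  exact exists_nhdsWithin_inter_hausdorffMeasure_eq_zero hm hn hφ' hψ'
    ((hφ.eventually_mem hxφ).mono fun y hy hyA => hy hyA.1)
    ((hψ.eventually_mem hxψ).mono fun y hy hyB => hS (hy (hB hyB))) (htrans x hx)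

lemma hausdorffMeasure_inter_eq_zero_of_not_perfectlyAlign {m n : ℕ}
    {N : Set (EuclideanSpace ℝ (Fin d))} (hr : 1 ≤ r) (hM : IsRegularSubmanifold r m M)
    (hN : IsRegularSubmanifold r n N) (hn : n < d) (h : ¬ PerfectlyAlign r m M n N) :
    Measure.hausdorffMeasure (m : ℝ) (M ∩ N) = 0 := by
  simp only [PerfectlyAlign, not_or, not_not] at h
  have h1 := hausdorffMeasure_manifoldInterior_inter hr hM.1 hn hN (fun _ hx => hx.1) h.1
  have h2 := hausdorffMeasure_manifoldInterior_inter hr hM.1 hn hN sdiff_subset h.2.1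
  refine measure_mono_null ?_
    (measure_union_null (measure_union_null h1 h2) (hM.hausdorffMeasure_manifoldBoundary hr))
  rintro x ⟨hxM, hxN⟩
  by_cases hx : x ∈ manifoldInterior r m M
  · by_cases hx' : x ∈ manifoldInterior r n N
    · exact Or.inl (Or.inl ⟨hx, hx'⟩)
    · exact Or.inl (Or.inr ⟨hx, hxN, hx'⟩)
  · exact Or.inr ⟨hxM, hx⟩

/-- Probability measures that live on submanifolds which do not perfectly align are mutually
singular. -/
lemma LivesOnLowDimManifold.mutuallySingular {m n : ℕ} {N : Set (EuclideanSpace ℝ (Fin d))}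
    {P Q : Measure (EuclideanSpace ℝ (Fin d))} (hr : 1 ≤ r) (hP : LivesOnLowDimManifold r P m M)
    (hQ : LivesOnLowDimManifold r Q n N) (h : ¬ PerfectlyAlign r m M n N) : P ⟂ₘ Q := by
  have hPM : P Mᶜ = 0 :=
    measure_mono_null (compl_subset_compl.2 hP.support_subset) Measure.measure_compl_support
  have hQN : Q Nᶜ = 0 :=
    measure_mono_null (compl_subset_compl.2 hQ.support_subset) Measure.measure_compl_support
  have hMN : P (M ∩ N) = 0 := hP.isContinuousIn _ inter_subset_left
    (hausdorffMeasure_inter_eq_zero_of_not_perfectlyAlign hr hP.isRegularSubmanifold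
      hQ.isRegularSubmanifold hQ.dim_lt h)
  -- The separating set is `N`, which is covered by `M ∩ N` and `Mᶜ`, both `P`-null.
  refine ⟨N, hQ.isClosed.measurableSet, measure_mono_null ?_ (measure_union_null hMN hPM), hQN⟩
  intro x hx
  by_cases hxM : x ∈ M
  · exact Or.inl ⟨hxM, hx⟩
  · exact Or.inr hxM

end Charts

theorem mainTheorem2 {d : ℕ} {r : WithTop ℕ∞} (hr : 1 ≤ r) :
    -- the Jensen-Shannon divergence of the two distributions is `log 2`
    (∀ (Ps Pt : Measure (EuclideanSpace ℝ (Fin d)))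
        [IsProbabilityMeasure Ps] [IsProbabilityMeasure Pt]
        (m n : ℕ) (M N : Set (EuclideanSpace ℝ (Fin d))),
        LivesOnLowDimManifold r Ps m M → LivesOnLowDimManifold r Pt n N →
        ¬ PerfectlyAlign r m M n N →
        jsDiv Ps Pt = ENNReal.ofReal (Real.log 2)) ∧
    -- for parametrized networks, the objective is constant and has zero gradients
    (∀ {X : Type*} [MeasurableSpace X] (μs μt : Measure X)
        [IsProbabilityMeasure μs] [IsProbabilityMeasure μt] (q : ℕ)
        (G : EuclideanSpace ℝ (Fin q) → X → EuclideanSpace ℝ (Fin d))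
        (T : EuclideanSpace ℝ (Fin q) → EuclideanSpace ℝ (Fin d) → EuclideanSpace ℝ (Fin d))
        (U : Set (EuclideanSpace ℝ (Fin q))),
        (∀ θ, Measurable (G θ)) → (∀ θ, Measurable (T θ)) → IsOpen U →
        (∀ θ ∈ U, ∃ (m n : ℕ) (M N : Set (EuclideanSpace ℝ (Fin d))),
          LivesOnLowDimManifold r (sourceLaw μs (G θ) (T θ)) m M ∧
          LivesOnLowDimManifold r (targetLaw μt (G θ)) n N ∧
          ¬ PerfectlyAlign r m M n N) →
        ∀ θ ∈ U,
          (∀ D : EuclideanSpace ℝ (Fin d) → ℝ≥0∞, IsDiscriminator D →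
            adversarialObjective μs μt D (G θ) (T θ) ≤ objectiveAtOptimum μs μt (G θ) (T θ)) ∧
          objectiveAtOptimum μs μt (G θ) (T θ) =
            ((2 * (jsDiv (sourceLaw μs (G θ) (T θ)) (targetLaw μt (G θ))).toReal
              - 2 * Real.log 2 : ℝ) : EReal) ∧
          jsDiv (sourceLaw μs (G θ) (T θ)) (targetLaw μt (G θ)) = ENNReal.ofReal (Real.log 2) ∧
          objectiveAtOptimum μs μt (G θ) (T θ) = 0 ∧
          HasGradientAt
            (fun η => (jsDiv (sourceLaw μs (G η) (T η)) (targetLaw μt (G η))).toReal) 0 θ ∧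
          HasGradientAt (fun η => (objectiveAtOptimum μs μt (G η) (T η)).toReal) 0 θ) := by
  refine ⟨fun Ps Pt _ _ m n M N hs ht h => jsDiv_of_mutuallySingular (hs.mutuallySingular hr ht h),
    ?_⟩
  intro X _ μs μt _ _ q G T U hG hT hU hlive
  have hsing : ∀ θ ∈ U, sourceLaw μs (G θ) (T θ) ⟂ₘ targetLaw μt (G θ) := by
    intro θ hθ
    obtain ⟨m, n, M, N, hs, ht, h⟩ := hlive θ hθ
    exact hs.mutuallySingular hr ht h
  have hjs : ∀ θ ∈ U, jsDiv (sourceLaw μs (G θ) (T θ)) (targetLaw μt (G θ)) =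
      ENNReal.ofReal (Real.log 2) := by
    intro θ hθ
    have : IsProbabilityMeasure (sourceLaw μs (G θ) (T θ)) :=
      Measure.isProbabilityMeasure_map ((hT θ).comp (hG θ)).aemeasurable
    have : IsProbabilityMeasure (targetLaw μt (G θ)) :=
      Measure.isProbabilityMeasure_map (hG θ).aemeasurable
    exact jsDiv_of_mutuallySingular (hsing θ hθ)
  have hobj : ∀ θ ∈ U, objectiveAtOptimum μs μt (G θ) (T θ) = 0 := fun θ hθ =>
    objectiveAtOptimum_of_mutuallySingular (hG θ) (hT θ) (hsing θ hθ)
  intro θ hθ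
  -- Constancy on the neighbourhood `U` of `θ` determines the gradient, with no regularity of `G`
  -- and `T` in the parameter.
  have hgrad : ∀ {f : EuclideanSpace ℝ (Fin q) → ℝ} {c : ℝ}, (∀ η ∈ U, f η = c) →
      HasGradientAt f 0 θ := fun {f c} hf =>
    (hasGradientAt_const θ c).congr_of_eventuallyEq
      (Filter.eventually_of_mem (hU.mem_nhds hθ) hf)
  refine ⟨fun D _ => ?_, ?_, hjs θ hθ, hobj θ hθ, ?_, ?_⟩
  · rw [hobj θ hθ]
    exact adversarialObjective_nonpos ..
  · rw [hobj θ hθ, hjs θ hθ, ENNReal.toReal_ofReal (Real.log_nonneg one_le_two)]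
    simp
  · exact hgrad fun η hη => congrArg ENNReal.toReal (hjs η hη)
  · exact hgrad fun η hη => congrArg EReal.toReal (hobj η hη)
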